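/- Theorem (Weierstrass division and preparation). Let $L$ be a discretely valued field with (non-archimedean, non-trivial) absolute value $|\cdot|$, and let $A$ be a unital $L$-Banach algebra whose norm is non-archimedean, submultiplicative, satisfies $\|1\|=1$, and is solid (every value $\|a\|$ is of the form $|c|$ with $c\in L$). Let $\alpha$ be an $L$-algebra automorphism of $A$ and $\delta$ an $L$-linear $\alpha$-derivation of $A$, i.e. $\delta(ab)=\alpha(a)\delta(b)+\delta(a)b$, with $\|\alpha(a)\|\le\|a\|$ and $\|\delta(a)\|\le\|a\|$ for all $a\in A$. Let $A[z,\alpha,\delta]$ be the Ore extension, whose elements are the skew-polynomials $\sum a_nz^n$ with $za=\alpha(a)z+\delta(a)$, and let $A\{z,\alpha,\delta\}$ be its completion for the Gauss norm $\|\sum a_nz^n\|=\max_n\|a_n\|$. For a normed ring $R$ as above put $\bar R=\{\|x\|\le1\}/\{\|x\|<1\}$. An element $f\in A\{z,\alpha,\delta\}$ is called regular of degree $d\ge 0$ if $\|f\|=1$ and its class in $\overline{A\{z,\alpha,\delta\}}$ has the form $\lambda \bar z^d+\sum_{i<d}c_i\bar z^i$ with $\lambda\in\bar L^{*}$ and $c_i\in\bar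 A$. Let $f\in A\{z,\alpha,\delta\}$ be regular of degree $d$. 1. (Division) For every $g\in A\{z,\alpha,\delta\}$ there are unique $q,r\in A\{z,\alpha,\delta\}$ with $g=qf+r$ and $r$ a skew-polynomial of degree $<d$ (so $r=0$ if $d=0$). Moreover $\|g\|=\max(\|q\|,\|r\|)$. 2. (Preparation) There are a monic skew-polynomial $w\in A[z,\alpha,\delta]$ of degree $d$, regular of degree $d$, and a unit $e$ of $A\{z,\alpha,\delta\}$ with $f=e\cdot w$, such that if $f\in A[z,\alpha,\delta]$ then also $e\in A[z,\alpha,\delta]$. If $\alpha$ is an isometry, there are also such $w$ and $e$ (in general different ones) with $f=w\cdot e$, again with $e\in A[z,\alpha,\delta]$ if $f\in A[z,\alpha,\delta]$. -/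

import Mathlib

open UniformSpace

noncomputable section

namespace SkewTate

/-- A normed field is discretely valued if its nonzero absolute values are exactly the integral
powers of `‖π‖` for some uniformizer `π` with `0 < ‖π‖ < 1`. -/
def IsDiscretelyValued (L : Type*) [NormedField L] : Prop :=
  ∃ π : L, 0 < ‖π‖ ∧ ‖π‖ < 1 ∧ ∀ x : L, x ≠ 0 → ∃ n : ℤ, ‖x‖ = ‖π‖ ^ n

/-- A norm on an `L`-vector space is solid if all its values are absolute values of `L`. -/
def IsSolid (L V : Type*) [NormedField L] [NormedAddCommGroup V] : Prop :=
  ∀ v : V, ∃ c : L, ‖v‖ = ‖c‖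

/-! ### Unit ball, open unit ball and residue ring of a non-archimedean normed ring -/

section Residue

variable (R : Type*) [NormedRing R] [NormOneClass R] [IsUltrametricDist R]

/-- `R⁰ = {x | ‖x‖ ≤ 1}`. -/
def unitBall : Subring R where
  carrier := {x | ‖x‖ ≤ 1}
  mul_mem' {a b} ha hb := (norm_mul_le a b).trans (mul_le_one₀ ha (norm_nonneg b) hb)
  one_mem' := norm_one.le
  add_mem' {a b} ha hb := (IsUltrametricDist.norm_add_le_max a b).trans (max_le ha hb)
  zero_mem' := by simp
  neg_mem' {a} ha := by simpa using ha

/-- `R⁰⁰ = {x | ‖x‖ < 1}`, as an ideal of `R⁰`. -/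
def openUnitBall : Ideal (unitBall R) where
  carrier := {x | ‖(x : R)‖ < 1}
  add_mem' {a b} ha hb :=
    (IsUltrametricDist.norm_add_le_max (a : R) (b : R)).trans_lt (max_lt ha hb)
  zero_mem' := by simp
  smul_mem' c x hx := (norm_mul_le (c : R) (x : R)).trans_lt
    ((mul_le_of_le_one_left (norm_nonneg _) c.2).trans_lt hx)

instance : (openUnitBall R).IsTwoSided where
  mul_mem_of_left {a} b ha := (norm_mul_le (a : R) (b : R)).trans_lt
    ((mul_le_of_le_one_right (norm_nonneg _) b.2).trans_lt ha)

/-- The residue ring `R̄ = R⁰ / R⁰⁰`. -/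
abbrev Residue : Type _ := unitBall R ⧸ openUnitBall R

variable {R}

/-- The class in `R̄` of an element of norm at most one. -/
def residue (x : R) (hx : ‖x‖ ≤ 1) : Residue R :=
  Ideal.Quotient.mk (openUnitBall R) ⟨x, hx⟩

variable {T : Type*} [NormedRing T] [NormOneClass T] [IsUltrametricDist T]

/-- The map `R⁰ → T⁰` induced by a norm-nonincreasing ring homomorphism `R → T`. -/
def unitBallMap (φ : R →+* T) (hφ : ∀ x, ‖φ x‖ ≤ ‖x‖) : unitBall R →+* unitBall T :=
  (φ.comp (unitBall R).subtype).codRestrict (unitBall T) fun x => (hφ x).trans x.2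

/-- The map `R̄ → T̄` induced by a norm-nonincreasing ring homomorphism `R → T`. -/
def residueMap (φ : R →+* T) (hφ : ∀ x, ‖φ x‖ ≤ ‖x‖) : Residue R →+* Residue T :=
  Ideal.quotientMap (openUnitBall T) (unitBallMap φ hφ) fun x hx => (hφ x).trans_lt hx

end Residue

/-! ### Ore extensions with their Gauss norm -/

/-- An `L`-algebra automorphism `α` of `A` and an `L`-linear `α`-derivation `δ` of `A`, both of
operator norm at most one. -/
structure OreDatum (L A : Type*) [NormedField L] [NormedRing A] [NormedAlgebra L A] where
  α : A ≃ₐ[L] A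
  δ : A →ₗ[L] A
  leibniz : ∀ a b, δ (a * b) = α a * δ b + δ a * b
  norm_α_le : ∀ a, ‖α a‖ ≤ ‖a‖
  norm_δ_le : ∀ a, ‖δ a‖ ≤ ‖a‖

section Ore

variable {L A : Type*} [NormedField L] [NormedRing A] [NormedAlgebra L A]

/-- The Ore extension `A[x, α, δ]`: the function `p : ℕ →₀ A` stands for `∑ p n * x ^ n`. -/
def Ore (_S : OreDatum L A) : Type _ := ℕ →₀ A

variable {S : OreDatum L A}

namespace Ore

instance : AddCommGroup (Ore S) := inferInstanceAs (AddCommGroup (ℕ →₀ A))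

instance : Module A (Ore S) := inferInstanceAs (Module A (ℕ →₀ A))

/-- The underlying finitely supported sequence of coefficients. -/
def toFinsupp (p : Ore S) : ℕ →₀ A := p

/-- The `n`-th (left) coefficient. -/
def coeff (p : Ore S) (n : ℕ) : A := p.toFinsupp n

/-- The monomial `a * x ^ n`. -/
def monomial (S : OreDatum L A) (n : ℕ) : A →+ Ore S :=
  (Finsupp.singleAddHom n : A →+ (ℕ →₀ A))

/-- Left multiplication by `x`: it sends `a * x ^ k` to `α a * x ^ (k + 1) + δ a * x ^ k`. -/
def mulX (S : OreDatum L A) : AddMonoid.End (Ore S) :=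
  (Finsupp.liftAddHom fun k =>
    (monomial S (k + 1)).comp (S.α : A →+ A) + (monomial S k).comp S.δ.toAddMonoidHom :
    (ℕ →₀ A) →+ Ore S)

/-- Left multiplication by `∑ p n * x ^ n`: it sends `q` to `∑ p n • (x ^ n * q)`. -/
def mulHom (S : OreDatum L A) : Ore S →+ AddMonoid.End (Ore S) :=
  (Finsupp.liftAddHom fun n =>
    (AddMonoidHom.mulRight (mulX S ^ n)).comp (Module.toAddMonoidEnd A (Ore S)).toAddMonoidHom :
    (ℕ →₀ A) →+ AddMonoid.End (Ore S))

@[ext]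
theorem ext {p q : Ore S} (h : ∀ n, p.coeff n = q.coeff n) : p = q :=
  Finsupp.ext h

@[simp]
theorem coeff_zero (n : ℕ) : (0 : Ore S).coeff n = 0 := rfl

@[simp]
theorem coeff_add (p q : Ore S) (n : ℕ) : (p + q).coeff n = p.coeff n + q.coeff n := rfl

@[simp]
theorem coeff_neg (p : Ore S) (n : ℕ) : (-p).coeff n = -p.coeff n := rfl

@[simp]
theorem coeff_smul (a : A) (p : Ore S) (n : ℕ) : (a • p).coeff n = a * p.coeff n := rfl

theorem coeff_monomial (k n : ℕ) (a : A) :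
    (monomial S k a).coeff n = if k = n then a else 0 :=
  Finsupp.single_apply

theorem smul_monomial (a b : A) (k : ℕ) : a • monomial S k b = monomial S k (a * b) :=
  Finsupp.smul_single a k b

theorem mulX_monomial (k : ℕ) (a : A) :
    mulX S (monomial S k a) = monomial S (k + 1) (S.α a) + monomial S k (S.δ a) :=
  Finsupp.liftAddHom_apply_single _ _ _

theorem mulHom_monomial (n : ℕ) (a : A) (q : Ore S) :
    mulHom S (monomial S n a) q = a • (mulX S ^ n) q :=
  congrArg (fun F : AddMonoid.End (Ore S) => F q) (Finsupp.liftAddHom_apply_single _ _ _)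

theorem mulHom_add (p q r : Ore S) :
    mulHom S (p + q) r = mulHom S p r + mulHom S q r := by
  rw [map_add]
  rfl

theorem mulHom_zero (r : Ore S) : mulHom S 0 r = 0 := by
  rw [map_zero]
  rfl

@[elab_as_elim]
theorem induction {P : Ore S → Prop} (p : Ore S) (h0 : P 0)
    (hadd : ∀ p q, P p → P q → P (p + q)) (hmon : ∀ n a, P (monomial S n a)) : P p :=
  Finsupp.induction_linear (motive := P) p h0 hadd hmon

theorem mulX_smul (a : A) (q : Ore S) :
    mulX S (a • q) = S.α a • mulX S q + S.δ a • q := by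
  induction q using Ore.induction with
  | h0 => simp
  | hadd p q hp hq => simp only [smul_add, map_add, hp, hq]; abel
  | hmon n b =>
    simp only [smul_monomial, mulX_monomial, smul_add, map_mul, S.leibniz, map_add]
    abel

theorem mulHom_smul (a : A) (p q : Ore S) : mulHom S (a • p) q = a • mulHom S p q := by
  induction p using Ore.induction with
  | h0 => simp only [smul_zero, mulHom_zero]
  | hadd p q hp hq => simp only [smul_add, mulHom_add, hp, hq]
  | hmon n b => rw [smul_monomial, mulHom_monomial, mulHom_monomial, mul_smul]

theorem mulHom_mulX (p q : Ore S) : mulHom S (mulX S p) q = mulX S (mulHom S p q) := by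
  induction p using Ore.induction with
  | h0 => rw [map_zero, mulHom_zero, map_zero]
  | hadd p q hp hq => rw [map_add, mulHom_add, mulHom_add, map_add, hp, hq]
  | hmon n b =>
    rw [mulX_monomial, mulHom_add, mulHom_monomial, mulHom_monomial,
      mulHom_monomial, mulX_smul, pow_succ']
    rfl

theorem mulHom_mulX_pow (n : ℕ) (p q : Ore S) :
    mulHom S ((mulX S ^ n) p) q = (mulX S ^ n) (mulHom S p q) := by
  induction n with
  | zero => rfl
  | succ n ih =>
    rw [pow_succ']
    exact (mulHom_mulX _ _).trans (congrArg (mulX S) ih)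

theorem mulHom_mulHom (p q r : Ore S) :
    mulHom S (mulHom S p q) r = mulHom S p (mulHom S q r) := by
  induction p using Ore.induction with
  | h0 => rw [mulHom_zero, mulHom_zero, mulHom_zero]
  | hadd p q hp hq => rw [mulHom_add, mulHom_add, mulHom_add, hp, hq]
  | hmon n b => rw [mulHom_monomial, mulHom_monomial, mulHom_smul, mulHom_mulX_pow]

theorem δ_one (S : OreDatum L A) : S.δ 1 = 0 := by
  have h := S.leibniz 1 1
  simpa using h

theorem mulX_pow_one (n : ℕ) : (mulX S ^ n) (monomial S 0 1) = monomial S n 1 := by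
  induction n with
  | zero => rfl
  | succ n ih =>
    rw [pow_succ']
    refine (congrArg (mulX S) ih).trans ?_
    rw [mulX_monomial, δ_one, map_one, map_zero, add_zero]

instance : Mul (Ore S) := ⟨fun p q => mulHom S p q⟩

instance : One (Ore S) := ⟨monomial S 0 1⟩

theorem mul_def (p q : Ore S) : p * q = mulHom S p q := rfl

theorem one_def : (1 : Ore S) = monomial S 0 1 := rfl

instance : Ring (Ore S) :=
  { (inferInstance : AddCommGroup (Ore S)), (inferInstance : Mul (Ore S)),
    (inferInstance : One (Ore S)) with
    left_distrib := fun p q r => map_add (mulHom S p) q r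
    right_distrib := fun p q r => mulHom_add p q r
    zero_mul := mulHom_zero
    mul_zero := fun p => map_zero (mulHom S p)
    mul_assoc := mulHom_mulHom
    one_mul := fun p => by rw [mul_def, one_def, mulHom_monomial, one_smul, pow_zero]; rfl
    mul_one := fun p => by
      induction p using Ore.induction with
      | h0 => exact mulHom_zero _
      | hadd p q hp hq =>
        rw [mul_def] at hp hq ⊢
        rw [mulHom_add, hp, hq]
      | hmon n b =>
        rw [mul_def, one_def, mulHom_monomial, mulX_pow_one, smul_monomial, mul_one] }

/-- The constants `A → A[x, α, δ]`. -/
def C (S : OreDatum L A) : A →+* Ore S where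
  toFun := monomial S 0
  map_one' := rfl
  map_mul' a b := by rw [mul_def, mulHom_monomial, pow_zero, ← smul_monomial]; rfl
  map_zero' := map_zero _
  map_add' := map_add _

/-- The variable `x`. -/
def X (S : OreDatum L A) : Ore S := monomial S 1 1

/-- The defining relation of the Ore extension. -/
theorem X_mul_C (a : A) : X S * C S a = C S (S.α a) * X S + C S (S.δ a) := by
  change mulHom S (monomial S 1 1) (monomial S 0 a) =
    mulHom S (monomial S 0 (S.α a)) (monomial S 1 1) + monomial S 0 (S.δ a)
  rw [mulHom_monomial, mulHom_monomial, one_smul, pow_one, pow_zero, mulX_monomial]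
  change _ = S.α a • monomial S 1 1 + _
  rw [smul_monomial, mul_one]

theorem monomial_eq (n : ℕ) (a : A) : monomial S n a = C S a * X S ^ n := by
  have hX : ∀ q : Ore S, X S * q = mulX S q := fun q => by
    change mulHom S (monomial S 1 1) q = _
    rw [mulHom_monomial, one_smul, pow_one]
  have h : X S ^ n = monomial S n 1 := by
    induction n with
    | zero => rfl
    | succ n ih => rw [pow_succ', ih, hX, mulX_monomial, δ_one, map_one, map_zero, add_zero]
  rw [h]
  change _ = mulHom S (monomial S 0 a) (monomial S n 1)
  rw [mulHom_monomial, pow_zero]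
  change _ = a • monomial S n 1
  rw [smul_monomial, mul_one]

/-- The Gauss norm `max_n ‖p n‖`. -/
def gaussNorm (p : Ore S) : NNReal :=
  p.toFinsupp.support.sup fun n => ‖p.coeff n‖₊

theorem gaussNorm_le_iff (p : Ore S) (c : NNReal) :
    gaussNorm p ≤ c ↔ ∀ n, ‖p.coeff n‖₊ ≤ c := by
  rw [gaussNorm, Finset.sup_le_iff]
  refine ⟨fun h n => ?_, fun h n _ => h n⟩
  by_cases hn : n ∈ p.toFinsupp.support
  · exact h n hn
  · have : p.coeff n = 0 := Finsupp.notMem_support_iff.mp hn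
    simp [this]

theorem coeff_le_gaussNorm (p : Ore S) (n : ℕ) : ‖p.coeff n‖₊ ≤ gaussNorm p :=
  (gaussNorm_le_iff p _).mp le_rfl n

instance : Norm (Ore S) := ⟨fun p => gaussNorm p⟩

theorem norm_def (p : Ore S) : ‖p‖ = gaussNorm p := rfl

theorem norm_coeff_le (p : Ore S) (n : ℕ) : ‖p.coeff n‖ ≤ ‖p‖ :=
  NNReal.coe_le_coe.mpr (coeff_le_gaussNorm p n)

theorem norm_le_of_coeff {p : Ore S} {c : ℝ} (hc : 0 ≤ c) (h : ∀ n, ‖p.coeff n‖ ≤ c) :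
    ‖p‖ ≤ c :=
  (gaussNorm_le_iff p ⟨c, hc⟩).mpr h

theorem norm_nonneg' (p : Ore S) : 0 ≤ ‖p‖ := NNReal.coe_nonneg _

theorem norm_monomial (n : ℕ) (a : A) : ‖monomial S n a‖ = ‖a‖ := by
  refine le_antisymm (norm_le_of_coeff (norm_nonneg a) fun k => ?_) ?_
  · rw [coeff_monomial]
    split_ifs <;> simp
  · simpa [coeff_monomial] using norm_coeff_le (monomial S n a) n

theorem norm_smul_le' (a : A) (p : Ore S) : ‖a • p‖ ≤ ‖a‖ * ‖p‖ :=
  norm_le_of_coeff (mul_nonneg (norm_nonneg a) (norm_nonneg' p)) fun n =>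
    (norm_mul_le a (p.coeff n)).trans
      (mul_le_mul_of_nonneg_left (norm_coeff_le p n) (norm_nonneg a))

theorem eq_sum_monomial (p : Ore S) :
    p = ∑ n ∈ p.toFinsupp.support, monomial S n (p.coeff n) :=
  (Finsupp.sum_single p.toFinsupp).symm

variable [IsUltrametricDist A]

theorem norm_add_le_max (p q : Ore S) : ‖p + q‖ ≤ max ‖p‖ ‖q‖ :=
  norm_le_of_coeff (le_max_of_le_left (norm_nonneg' p)) fun n =>
    (IsUltrametricDist.norm_add_le_max (p.coeff n) (q.coeff n)).trans
      (max_le_max (norm_coeff_le p n) (norm_coeff_le q n))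

instance : NormedAddCommGroup (Ore S) :=
  AddGroupNorm.toNormedAddCommGroup
    { toFun := fun p => ‖p‖
      map_zero' := le_antisymm (norm_le_of_coeff le_rfl fun n => by simp) (norm_nonneg' _)
      add_le' := fun p q => (norm_add_le_max p q).trans
        (max_le_add_of_nonneg (norm_nonneg' p) (norm_nonneg' q))
      neg' := fun p => le_antisymm
        (norm_le_of_coeff (norm_nonneg' _) fun n => by simpa using norm_coeff_le p n)
        (norm_le_of_coeff (norm_nonneg' _) fun n => by simpa using norm_coeff_le (-p) n)
      eq_zero_of_map_eq_zero' := fun p hp => by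
        ext n
        exact norm_le_zero_iff.mp ((norm_coeff_le p n).trans (le_of_eq hp)) }

instance : IsUltrametricDist (Ore S) :=
  IsUltrametricDist.isUltrametricDist_of_forall_norm_add_le_max_norm norm_add_le_max

theorem norm_mulX_le (p : Ore S) : ‖mulX S p‖ ≤ ‖p‖ := by
  conv_lhs => rw [eq_sum_monomial p, map_sum]
  refine IsUltrametricDist.norm_sum_le_of_forall_le_of_nonneg (norm_nonneg' p) fun n _ => ?_
  rw [mulX_monomial]
  refine (norm_add_le_max _ _).trans (max_le ?_ ?_)
  · rw [norm_monomial]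
    exact (S.norm_α_le _).trans (norm_coeff_le p n)
  · rw [norm_monomial]
    exact (S.norm_δ_le _).trans (norm_coeff_le p n)

theorem norm_mulX_pow_le (n : ℕ) (p : Ore S) : ‖(mulX S ^ n) p‖ ≤ ‖p‖ := by
  induction n with
  | zero => exact le_rfl
  | succ n ih =>
    rw [pow_succ']
    exact (norm_mulX_le _).trans ih

/-- The Gauss norm is submultiplicative. -/
theorem norm_mul_le' (p q : Ore S) : ‖p * q‖ ≤ ‖p‖ * ‖q‖ := by
  have h : p * q = ∑ n ∈ p.toFinsupp.support, p.coeff n • (mulX S ^ n) q := by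
    conv_lhs => rw [eq_sum_monomial p, Finset.sum_mul]
    exact Finset.sum_congr rfl fun n _ => mulHom_monomial _ _ _
  rw [h]
  refine IsUltrametricDist.norm_sum_le_of_forall_le_of_nonneg
    (mul_nonneg (norm_nonneg' p) (norm_nonneg' q)) fun n _ => ?_
  exact (norm_smul_le' _ _).trans (mul_le_mul (norm_coeff_le p n) (norm_mulX_pow_le n q)
    (norm_nonneg' _) (norm_nonneg' p))

instance : NormedRing (Ore S) :=
  { (inferInstance : Ring (Ore S)), (inferInstance : NormedAddCommGroup (Ore S)) with
    norm_mul_le := norm_mul_le' }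

instance [NormOneClass A] : NormOneClass (Ore S) :=
  ⟨(norm_monomial 0 (1 : A)).trans norm_one⟩

end Ore

/-! ### The completed Ore extension -/

variable [IsUltrametricDist A]

/-- `A{x, α, δ}`: the completion of the Ore extension `A[x, α, δ]` for the Gauss norm. -/
abbrev Alg (S : OreDatum L A) : Type _ := Completion (Ore S)

/-- The embedding `A[x, α, δ] → A{x, α, δ}`. -/
def ofOre (S : OreDatum L A) : Ore S →+* Alg S := Completion.coeRingHom

theorem norm_ofOre (p : Ore S) : ‖ofOre S p‖ = ‖p‖ := Completion.norm_coe p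

instance : IsUltrametricDist (Alg S) :=
  IsUltrametricDist.isUltrametricDist_of_forall_norm_add_le_max_norm fun x y => by
    induction x, y using Completion.induction_on₂ with
    | hp => exact isClosed_le (by fun_prop) (by fun_prop)
    | ih p q =>
      rw [← Completion.coe_add, Completion.norm_coe, Completion.norm_coe, Completion.norm_coe]
      exact Ore.norm_add_le_max p q

/-- The embedding `A → A{x, α, δ}`. -/
def const (S : OreDatum L A) : A →+* Alg S := (ofOre S).comp (Ore.C S)

theorem norm_const_le (S : OreDatum L A) (a : A) : ‖const S a‖ ≤ ‖a‖ :=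
  ((norm_ofOre _).trans (Ore.norm_monomial 0 a)).le

variable [NormOneClass A]

instance : NormOneClass (Alg S) :=
  ⟨by rw [← map_one (ofOre S), norm_ofOre, norm_one]⟩

/-- The embedding `L → A{x, α, δ}`. -/
def scalar (S : OreDatum L A) : L →+* Alg S := (const S).comp (algebraMap L A)

theorem norm_scalar_le (S : OreDatum L A) (c : L) : ‖scalar S c‖ ≤ ‖c‖ :=
  (norm_const_le S _).trans (norm_algebraMap' A c).le

/-- The variable of `A{x, α, δ}`. -/
def var (S : OreDatum L A) : Alg S := ofOre S (Ore.X S)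

theorem norm_var_le (S : OreDatum L A) : ‖var S‖ ≤ 1 :=
  ((norm_ofOre _).trans ((Ore.norm_monomial 1 (1 : A)).trans norm_one)).le

/-- `f` lies in `A[x, α, δ]`. -/
def IsPoly (S : OreDatum L A) (f : Alg S) : Prop := ∃ p : Ore S, f = ofOre S p

/-- `f` is a skew-polynomial of degree less than `d`; for `d = 0` this says `f = 0`. -/
def DegreeLT (S : OreDatum L A) (d : ℕ) (f : Alg S) : Prop :=
  ∃ p : Ore S, (∀ n, d ≤ n → p.coeff n = 0) ∧ f = ofOre S p

/-- `f` is a monic skew-polynomial of degree `d`. -/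
def IsMonicOfDegree (S : OreDatum L A) (d : ℕ) (f : Alg S) : Prop :=
  ∃ p : Ore S, p.coeff d = 1 ∧ (∀ n, d < n → p.coeff n = 0) ∧ f = ofOre S p

/-- `f` is regular of degree `d`: it has norm one, and in the residue ring of `A{x, α, δ}` its
class is `λ z ^ d + ∑_{i < d} c i z ^ i` with `λ` a unit of the residue field of `L`, the `c i` in
the residue ring of `A`, and `z` the class of the variable. -/
def IsRegular [IsUltrametricDist L] (S : OreDatum L A) (d : ℕ) (f : Alg S) : Prop :=
  ∃ hf : ‖f‖ = 1, ∃ (l : (Residue L)ˣ) (c : Fin d → Residue A),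
    residue f hf.le =
      residueMap (scalar S) (norm_scalar_le S) (l : Residue L) * residue (var S) (norm_var_le S) ^ d
        + ∑ i : Fin d, residueMap (const S) (norm_const_le S) (c i) *
            residue (var S) (norm_var_le S) ^ (i : ℕ)

end Ore

end SkewTate

end

open UniformSpace

namespace SkewTate

section Ore

variable {L A : Type*} [NormedField L] [NormedRing A] [NormedAlgebra L A] {S : OreDatum L A}

/-! ### Degrees and leading coefficients of skew-polynomials. -/

namespace Ore

/-! A regular `f` lies at distance `ε < 1` from a skew-polynomial `p` of degree `d` whose leading
coefficient is a scalar `l` with `‖l‖ = 1` (`IsRegular.exists_ore`). Right multiplication by `p`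
turns a leading coefficient `a` in degree `n` into `a * l` in degree `n + d`, because `α` fixes
scalars. Hence polynomials can be divided by cancelling top terms, and `‖q‖ ≤ ‖q * p + r‖` whenever
`r` has degree `< d` (`IsShift`).

Replacing `p` by `f` costs at most `ε * ‖q‖`, so by the ultrametric inequality and density `‖q * f +
r‖ = max ‖q‖ ‖r‖` on the completion (`IsNearShift.norm_add_eq`). This gives uniqueness and makes
`(q, r) ↦ q * f + r` an isometry, whose range is closed; polynomial division approximates every
element from this range up to a fixed factor `< 1`, so the range is everything.

For preparation, divide `z ^ d = q * f + r`. The norm identity forces `q` to be close to `l⁻¹`,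
hence a unit, and `w = z ^ d - r` is monic. The other side uses left multiplication, where leading
coefficients become `l * α^d(a)`; this is where `α` must be an isometry. -/

theorem _root_.IsUltrametricDist.norm_sub_le_max_norm {E : Type*} [SeminormedAddCommGroup E]
    [IsUltrametricDist E] (x y : E) : ‖x - y‖ ≤ max ‖x‖ ‖y‖ := by
  rw [sub_eq_add_neg, ← norm_neg y]
  exact IsUltrametricDist.norm_add_le_max x (-y)

/-- All coefficients of index at least `N` vanish. -/
def DegLT (N : ℕ) (p : Ore S) : Prop := ∀ n, N ≤ n → p.coeff n = 0

theorem DegLT.add {N : ℕ} {p q : Ore S} (hp : DegLT N p) (hq : DegLT N q) : DegLT N (p + q) :=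
  fun n hn => by rw [coeff_add, hp n hn, hq n hn, add_zero]

theorem DegLT.neg {N : ℕ} {p : Ore S} (hp : DegLT N p) : DegLT N (-p) :=
  fun n hn => by rw [coeff_neg, hp n hn, neg_zero]

theorem DegLT.sub {N : ℕ} {p q : Ore S} (hp : DegLT N p) (hq : DegLT N q) : DegLT N (p - q) := by
  rw [sub_eq_add_neg]
  exact hp.add hq.neg

theorem DegLT.mono {M N : ℕ} {p : Ore S} (hp : DegLT M p) (h : M ≤ N) : DegLT N p :=
  fun n hn => hp n (h.trans hn)

theorem degLT_zero_iff {p : Ore S} : DegLT 0 p ↔ p = 0 :=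
  ⟨fun h => ext fun n => h n (Nat.zero_le n), fun h => by rw [h]; exact fun n _ => coeff_zero n⟩

theorem degLT_zero (N : ℕ) : DegLT N (0 : Ore S) := fun n _ => coeff_zero n

theorem degLT_monomial (n : ℕ) (a : A) : DegLT (n + 1) (monomial S n a) := fun k hk => by
  rw [coeff_monomial, if_neg (by omega)]

theorem exists_degLT (p : Ore S) : ∃ N, DegLT N p := by
  refine ⟨p.toFinsupp.support.sup id + 1, fun n hn => ?_⟩
  by_contra h
  have hmem : n ∈ p.toFinsupp.support := Finsupp.mem_support_iff.mpr h
  have := Finset.le_sup (f := id) hmem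
  simp only [id] at this
  omega

theorem coeff_sub (p q : Ore S) (n : ℕ) : (p - q).coeff n = p.coeff n - q.coeff n := rfl

theorem DegLT.sub_monomial {N : ℕ} {p : Ore S} (hp : DegLT (N + 1) p) :
    DegLT N (p - monomial S N (p.coeff N)) := fun n hn => by
  rw [coeff_sub, coeff_monomial]
  rcases hn.eq_or_lt with rfl | h
  · simp
  · rw [if_neg h.ne, hp n h, sub_zero]

/-- Induction on the degree, adding leading monomials one at a time. -/
theorem DegLT.induction {P : ℕ → Ore S → Prop} (h0 : P 0 0)
    (hstep : ∀ N p a, DegLT N p → P N p → P (N + 1) (p + monomial S N a))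
    {N : ℕ} {p : Ore S} (hp : DegLT N p) : P N p := by
  induction N generalizing p with
  | zero => rw [degLT_zero_iff.mp hp]; exact h0
  | succ N ih =>
    have := hstep N _ (p.coeff N) hp.sub_monomial (ih hp.sub_monomial)
    rwa [sub_add_cancel] at this

theorem coeff_mulX_succ (p : Ore S) (k : ℕ) :
    (mulX S p).coeff (k + 1) = S.α (p.coeff k) + S.δ (p.coeff (k + 1)) := by
  induction p using Ore.induction with
  | h0 => simp
  | hadd p q hp hq => simp only [map_add, coeff_add, hp, hq]; abel
  | hmon n b => simp only [mulX_monomial, coeff_add, coeff_monomial]; split_ifs <;> simp_all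

theorem mulX_pow_succ (m : ℕ) (q : Ore S) : (mulX S ^ (m + 1)) q = mulX S ((mulX S ^ m) q) := by
  rw [pow_succ']
  rfl

theorem DegLT.mulX_pow {n : ℕ} {q : Ore S} (hq : DegLT n q) (m : ℕ) :
    DegLT (m + n) ((mulX S ^ m) q) := by
  induction m with
  | zero => rw [zero_add]; exact hq
  | succ m ih =>
    intro k hk
    obtain ⟨k, rfl⟩ : ∃ j, k = j + 1 := ⟨k - 1, by omega⟩
    rw [mulX_pow_succ, coeff_mulX_succ, ih k (by omega), ih (k + 1) (by omega), map_zero, map_zero,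
      add_zero]

/-- Each multiplication by the variable raises the degree only through `α`; the `δ` terms stay below
the top. -/
theorem coeff_mulX_pow {n : ℕ} {q : Ore S} (hq : DegLT (n + 1) q) (m : ℕ) :
    ((mulX S ^ m) q).coeff (m + n) = (S.α)^[m] (q.coeff n) := by
  induction m with
  | zero => rw [zero_add]; rfl
  | succ m ih =>
    rw [mulX_pow_succ, show m + 1 + n = m + n + 1 by omega, coeff_mulX_succ, ih,
      hq.mulX_pow m _ (by omega), map_zero, add_zero, Function.iterate_succ_apply']

theorem monomial_mul (n : ℕ) (a : A) (q : Ore S) :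
    monomial S n a * q = a • (mulX S ^ n) q := mulHom_monomial n a q

theorem DegLT.mul {m n : ℕ} {p q : Ore S} (hp : DegLT (m + 1) p) (hq : DegLT n q) :
    DegLT (m + n) (p * q) := by
  -- The target bound `m + n` stays fixed while the induction runs over the degree of `p`.
  have key : ∀ {M : ℕ} {p : Ore S}, DegLT M p → M ≤ m + 1 → DegLT (m + n) (p * q) := by
    intro M p hp
    refine DegLT.induction (P := fun M p => M ≤ m + 1 → DegLT (m + n) (p * q)) ?_ ?_ hp
    · intro _
      rw [zero_mul]
      exact degLT_zero _
    · intro N p a _ ih hN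
      rw [add_mul, monomial_mul]
      refine (ih (by omega)).add fun k hk => ?_
      rw [coeff_smul, hq.mulX_pow N k (by omega), mul_zero]
  exact key hp le_rfl

/-- The leading coefficient of a product of skew-polynomials. -/
theorem coeff_mul_add {m n : ℕ} {p q : Ore S} (hp : DegLT (m + 1) p) (hq : DegLT (n + 1) q) :
    (p * q).coeff (m + n) = p.coeff m * (S.α)^[m] (q.coeff n) := by
  have h : ((p - monomial S m (p.coeff m)) * q).coeff (m + n) = 0 := by
    rcases m with _ | m
    · rw [degLT_zero_iff.mp hp.sub_monomial, zero_mul, coeff_zero]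
    · exact DegLT.mul hp.sub_monomial hq _ (by omega)
  rw [sub_mul, coeff_sub, sub_eq_zero, monomial_mul, coeff_smul, coeff_mulX_pow hq] at h
  exact h

theorem δ_algebraMap (S : OreDatum L A) (c : L) : S.δ (algebraMap L A c) = 0 := by
  rw [Algebra.algebraMap_eq_smul_one, map_smul, δ_one, smul_zero]

/-- Scalars are central in `A`, fixed by `α` and killed by `δ`. Needed to move `l⁻¹` across `p` in
the left-handed preparation. -/
theorem commute_C_algebraMap (c : L) (p : Ore S) : Commute (C S (algebraMap L A c)) p := by
  have hX : Commute (C S (algebraMap L A c)) (X S) := by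
    have h := X_mul_C (S := S) (algebraMap L A c)
    rw [δ_algebraMap, map_zero, add_zero, AlgEquiv.commutes] at h
    exact h.symm
  induction p using Ore.induction with
  | h0 => exact Commute.zero_right _
  | hadd p q hp hq => exact hp.add_right hq
  | hmon n b =>
    rw [monomial_eq]
    refine Commute.mul_right ?_ (hX.pow_right n)
    exact Commute.map (show Commute _ _ from Algebra.commutes c b) (C S)

theorem C_mul (a : A) (p : Ore S) : C S a * p = a • p := by
  change monomial S 0 a * p = _
  rw [monomial_mul, pow_zero]
  rfl

theorem iterate_α_algebraMap (S : OreDatum L A) (n : ℕ) (c : L) :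
    (S.α)^[n] (algebraMap L A c) = algebraMap L A c :=
  Function.iterate_fixed (S.α.commutes c) n

/-! ### Remainders as coefficient vectors. -/

/-- The skew-polynomial of degree less than `d` with given coefficients. -/
noncomputable def ofCoeffs (S : OreDatum L A) (d : ℕ) : (Fin d → A) →+ Ore S where
  toFun c := ∑ i : Fin d, monomial S i (c i)
  map_zero' := by simp
  map_add' c c' := by simp [Finset.sum_add_distrib]

theorem coeff_sum {ι : Type*} (s : Finset ι) (p : ι → Ore S) (n : ℕ) :
    (∑ i ∈ s, p i).coeff n = ∑ i ∈ s, (p i).coeff n :=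
  map_sum (⟨⟨fun p => p.coeff n, rfl⟩, fun _ _ => rfl⟩ : Ore S →+ A) p s

theorem coeff_ofCoeffs {d : ℕ} (c : Fin d → A) (n : ℕ) :
    (ofCoeffs S d c).coeff n = if h : n < d then c ⟨n, h⟩ else 0 := by
  change (∑ i : Fin d, monomial S i (c i)).coeff n = _
  simp only [coeff_sum, coeff_monomial]
  split_ifs with h
  · rw [Finset.sum_eq_single ⟨n, h⟩]
    · simp
    · intro i _ hi
      exact if_neg fun h' => hi (Fin.ext h')
    · simp
  · exact Finset.sum_eq_zero fun i _ => if_neg (by omega)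

theorem degLT_ofCoeffs {d : ℕ} (c : Fin d → A) : DegLT d (ofCoeffs S d c) := fun n hn => by
  rw [coeff_ofCoeffs, dif_neg (by omega)]

theorem DegLT.eq_ofCoeffs {d : ℕ} {p : Ore S} (hp : DegLT d p) :
    p = ofCoeffs S d fun i => p.coeff i := by
  ext n
  rw [coeff_ofCoeffs]
  split_ifs with h
  · rfl
  · exact hp n (by omega)

/-- Identifies remainders isometrically with `Fin d → A`, which is complete when `A` is; this serves
to close the range of `divMap`. -/
theorem norm_ofCoeffs {d : ℕ} (c : Fin d → A) : ‖ofCoeffs S d c‖ = ‖c‖ := by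
  refine le_antisymm (norm_le_of_coeff (norm_nonneg c) fun n => ?_)
    ((pi_norm_le_iff_of_nonneg (norm_nonneg' _)).mpr fun i => ?_)
  · rw [coeff_ofCoeffs]
    split_ifs with h
    · exact norm_le_pi_norm c _
    · simp
  · simpa [coeff_ofCoeffs] using norm_coeff_le (ofCoeffs S d c) i

/-! ### Division of skew-polynomials by a degree shift. -/

/-- An additive endomorphism of the Ore extension that does not increase the Gauss norm and
raises degrees by `d`, transforming leading coefficients by a norm-preserving bijection. -/
structure IsShift (d : ℕ) (P : Ore S →+ Ore S) : Prop where
  norm_le : ∀ q, ‖P q‖ ≤ ‖q‖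
  degLT : ∀ n a, DegLT (n + d + 1) (P (monomial S n a))
  norm_coeff : ∀ n a, ‖(P (monomial S n a)).coeff (n + d)‖ = ‖a‖
  exists_coeff : ∀ n b, ∃ a, (P (monomial S n a)).coeff (n + d) = b

namespace IsShift

variable {d : ℕ} {P : Ore S →+ Ore S}

theorem degLT_apply (hP : IsShift d P) {N : ℕ} {q : Ore S} (hq : DegLT N q) :
    DegLT (N + d) (P q) := by
  refine DegLT.induction (P := fun N q => DegLT (N + d) (P q)) ?_ ?_ hq
  · rw [map_zero]
    exact degLT_zero _
  · intro N p a _ ih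
    rw [map_add]
    exact (ih.mono (by omega)).add ((hP.degLT N a).mono (by omega))

/-- Division with remainder of skew-polynomials. -/
theorem exists_eq_add (hP : IsShift d P) (g : Ore S) : ∃ q r, g = P q + r ∧ DegLT d r := by
  have key : ∀ N, ∀ g : Ore S, DegLT (N + d) g → ∃ q r, g = P q + r ∧ DegLT d r := by
    intro N
    induction N with
    | zero =>
      intro g hg
      exact ⟨0, g, by rw [map_zero, zero_add], by rwa [zero_add] at hg⟩
    | succ N ih =>
      intro g hg
      -- The monomial of degree `N` whose image cancels the top coefficient of `g`.
      obtain ⟨a, ha⟩ := hP.exists_coeff N (g.coeff (N + d))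
      obtain ⟨q, r, h, hr⟩ := ih (g - P (monomial S N a)) fun n hn => by
        rw [coeff_sub]
        rcases hn.eq_or_lt with rfl | hlt
        · rw [ha, sub_self]
        · rw [hg n (by omega), hP.degLT N a n (by omega), sub_zero]
      refine ⟨q + monomial S N a, r, ?_, hr⟩
      rw [map_add, add_right_comm, ← h, sub_add_cancel]
  obtain ⟨N, hN⟩ := exists_degLT g
  exact key N g (hN.mono (by omega))

variable [IsUltrametricDist A]

/-- At index `N + d` only the leading monomial of `q` contributes, so its coefficient is bounded by
`‖P q + r‖`; subtract it and repeat. -/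
theorem norm_le_norm_add (hP : IsShift d P) (q : Ore S) {r : Ore S} (hr : DegLT d r) :
    ‖q‖ ≤ ‖P q + r‖ := by
  obtain ⟨N, hq⟩ := exists_degLT q
  -- A free bound `c` survives the removal of the leading monomial, whereas `‖P q + r‖` itself
  -- changes.
  suffices h : ∀ c, ‖P q + r‖ ≤ c → ‖q‖ ≤ c from h _ le_rfl
  refine DegLT.induction (P := fun N q => ∀ c, ‖P q + r‖ ≤ c → ‖q‖ ≤ c) ?_ ?_ hq
  · intro c hc
    rw [norm_zero]
    exact (norm_nonneg _).trans hc
  · intro N p a hp ih c hc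
    have ha : ‖a‖ ≤ c := by
      have h := (norm_coeff_le (P (p + monomial S N a) + r) (N + d)).trans hc
      rwa [map_add, coeff_add, coeff_add, hP.degLT_apply hp _ le_rfl, hr _ (by omega), zero_add,
        add_zero, hP.norm_coeff] at h
    have hm : ‖P (monomial S N a)‖ ≤ c :=
      (hP.norm_le _).trans ((norm_monomial N a).le.trans ha)
    have hp' : ‖p‖ ≤ c := by
      refine ih c ?_
      have e : P p + r = (P (p + monomial S N a) + r) - P (monomial S N a) := by
        rw [map_add]; abel
      rw [e]
      exact (IsUltrametricDist.norm_sub_le_max_norm _ _).trans (max_le hc hm)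
    exact (norm_add_le_max _ _).trans (max_le hp' ((norm_monomial N a).le.trans ha))

end IsShift

variable [IsUltrametricDist A]

/-- Here `α` acts only on the leading scalar of `p`, which it fixes: leading coefficients are just
multiplied by `l`. -/
theorem isShift_mulRight {d : ℕ} {p : Ore S} (hp : DegLT (d + 1) p) (hn : ‖p‖ ≤ 1)
    {l : L} (hl : ‖l‖ = 1) (hd : p.coeff d = algebraMap L A l) :
    IsShift d (AddMonoidHom.mulRight p) where
  norm_le q := (norm_mul_le q p).trans (mul_le_of_le_one_right (norm_nonneg q) hn)
  degLT n a := (degLT_monomial n a).mul hp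
  norm_coeff n a := by
    rw [AddMonoidHom.mulRight_apply, coeff_mul_add (degLT_monomial n a) hp, hd,
      iterate_α_algebraMap, coeff_monomial, if_pos rfl, ← Algebra.commutes, ← Algebra.smul_def,
      norm_smul, hl, one_mul]
  exists_coeff n b := by
    have hl0 : l ≠ 0 := by rintro rfl; simp at hl
    refine ⟨l⁻¹ • b, ?_⟩
    rw [AddMonoidHom.mulRight_apply, coeff_mul_add (degLT_monomial n _) hp, hd,
      iterate_α_algebraMap, coeff_monomial, if_pos rfl, ← Algebra.commutes, ← Algebra.smul_def,
      smul_inv_smul₀ hl0]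

/-- Now `α^d` hits the leading coefficient of the argument: bijectivity comes from `α` being an
automorphism, norm preservation from its being an isometry. -/
theorem isShift_mulLeft (hα : Isometry S.α) {d : ℕ} {p : Ore S} (hp : DegLT (d + 1) p)
    (hn : ‖p‖ ≤ 1) {l : L} (hl : ‖l‖ = 1) (hd : p.coeff d = algebraMap L A l) :
    IsShift d (AddMonoidHom.mulLeft p) where
  norm_le q := (norm_mul_le p q).trans (mul_le_of_le_one_left (norm_nonneg q) hn)
  degLT n a := (hp.mul (degLT_monomial n a)).mono (by omega)
  norm_coeff n a := by
    have hα' : ∀ m a, ‖(S.α)^[m] a‖ = ‖a‖ := fun m a => by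
      induction m with
      | zero => rfl
      | succ m ih =>
        rw [Function.iterate_succ_apply', ← ih]
        exact hα.norm_map_of_map_zero (map_zero _) _
    rw [AddMonoidHom.coe_mulLeft, add_comm n d, coeff_mul_add hp (degLT_monomial n a), hd,
      coeff_monomial, if_pos rfl, ← Algebra.smul_def, norm_smul, hl, one_mul, hα']
  exists_coeff n b := by
    have hl0 : l ≠ 0 := by rintro rfl; simp at hl
    obtain ⟨a, ha⟩ := S.α.surjective.iterate d (l⁻¹ • b)
    refine ⟨a, ?_⟩
    rw [AddMonoidHom.coe_mulLeft, add_comm n d, coeff_mul_add hp (degLT_monomial n a), hd,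
      coeff_monomial, if_pos rfl, ha, ← Algebra.smul_def, smul_inv_smul₀ hl0]

end Ore

/-! ### Division in the completion -/

section Division

variable [IsUltrametricDist A]

theorem DegreeLT.sub {d : ℕ} {r r' : Alg S} (hr : DegreeLT S d r) (hr' : DegreeLT S d r') :
    DegreeLT S d (r - r') := by
  obtain ⟨p, hp, rfl⟩ := hr
  obtain ⟨p', hp', rfl⟩ := hr'
  exact ⟨p - p', Ore.DegLT.sub hp hp', (map_sub _ _ _).symm⟩

/-- An additive endomorphism of the completion that is strictly close to a degree shift of the
Ore extension. -/
structure IsNearShift (d : ℕ) (T : Alg S →+ Alg S) : Prop where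
  norm_le : ∀ q, ‖T q‖ ≤ ‖q‖
  exists_shift : ∃ P : Ore S →+ Ore S, Ore.IsShift d P ∧
    ∃ ε : ℝ, 0 ≤ ε ∧ ε < 1 ∧ ∀ p, ‖T (ofOre S p) - ofOre S (P p)‖ ≤ ε * ‖p‖

namespace IsNearShift

variable {d : ℕ} {T : Alg S →+ Alg S}

theorem continuous (hT : IsNearShift d T) : Continuous T :=
  AddMonoidHomClass.continuous_of_bound T 1 fun q => by simpa using hT.norm_le q

/-- By density `q` may be a polynomial `p`. If `‖T p + r‖ < ‖p‖`, then `P p + r`, which differs from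
it by less than `‖p‖`, violates the estimate for the shift `P`. -/
theorem norm_le_norm_add (hT : IsNearShift d T) (q : Alg S) {r : Alg S} (hr : DegreeLT S d r) :
    ‖q‖ ≤ ‖T q + r‖ := by
  obtain ⟨P, hP, ε, _, hε, hTP⟩ := hT.exists_shift
  obtain ⟨r, hr, rfl⟩ := hr
  have hc := hT.continuous
  induction q using Completion.induction_on with
  | hp => exact isClosed_le (by fun_prop) (by fun_prop)
  | ih p =>
    change ‖ofOre S p‖ ≤ ‖T (ofOre S p) + ofOre S r‖
    rw [norm_ofOre]
    by_contra! hlt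
    have h1 : ‖ofOre S (P p + r)‖ ≤
        max ‖T (ofOre S p) + ofOre S r‖ ‖T (ofOre S p) - ofOre S (P p)‖ := by
      have e : ofOre S (P p + r) =
          (T (ofOre S p) + ofOre S r) - (T (ofOre S p) - ofOre S (P p)) := by
        rw [map_add]; abel
      rw [e]
      exact IsUltrametricDist.norm_sub_le_max_norm _ _
    rw [norm_ofOre] at h1
    have hp : 0 < ‖p‖ := (norm_nonneg _).trans_lt hlt
    have h2 : ‖T (ofOre S p) - ofOre S (P p)‖ < ‖p‖ :=
      (hTP p).trans_lt (mul_lt_of_lt_one_left hp hε)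
    exact absurd ((hP.norm_le_norm_add p hr).trans h1) (not_le.mpr (max_lt hlt h2))

/-- The bound on `q` also bounds `r = (T q + r) - T q`. -/
theorem norm_add_eq (hT : IsNearShift d T) (q : Alg S) {r : Alg S} (hr : DegreeLT S d r) :
    ‖T q + r‖ = max ‖q‖ ‖r‖ := by
  have h := hT.norm_le_norm_add q hr
  refine le_antisymm ((IsUltrametricDist.norm_add_le_max _ _).trans
    (max_le_max_right _ (hT.norm_le q))) (max_le h ?_)
  have e : r = (T q + r) - T q := by abel
  conv_lhs => rw [e]
  exact (IsUltrametricDist.norm_sub_le_max_norm _ _).trans (max_le le_rfl ((hT.norm_le q).trans h))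

theorem unique (hT : IsNearShift d T) {q r q' r' : Alg S} (hr : DegreeLT S d r)
    (hr' : DegreeLT S d r') (h : T q + r = T q' + r') : q = q' ∧ r = r' := by
  have h0 : T (q - q') + (r - r') = 0 := by
    rw [map_sub, sub_add_sub_comm, h, sub_self]
  have hn := hT.norm_add_eq (q - q') (hr.sub hr')
  rw [h0, norm_zero] at hn
  exact ⟨sub_eq_zero.mp (norm_le_zero_iff.mp ((le_max_left _ _).trans hn.ge)),
    sub_eq_zero.mp (norm_le_zero_iff.mp ((le_max_right _ _).trans hn.ge))⟩

/-- The map `(q, c) ↦ T q + ∑ c i * x ^ i`. -/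
noncomputable def divMap (d : ℕ) (T : Alg S →+ Alg S) : Alg S × (Fin d → A) →+ Alg S :=
  T.coprod ((ofOre S).toAddMonoidHom.comp (Ore.ofCoeffs S d))

theorem isometry_divMap (hT : IsNearShift d T) : Isometry (divMap d T) := by
  refine AddMonoidHomClass.isometry_of_norm _ fun x => ?_
  have h := hT.norm_add_eq x.1 ⟨_, Ore.degLT_ofCoeffs (S := S) x.2, rfl⟩
  rw [norm_ofOre, Ore.norm_ofCoeffs] at h
  exact h

/-- Approximating the successive errors leaves an error of at most `ε ^ n * ‖g‖`, so `g` is a limit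
of elements of `M`. -/
theorem _root_.AddSubgroup.eq_top_of_isClosed_of_contracting {E : Type*} [SeminormedAddCommGroup E]
    (M : AddSubgroup E) (hM : IsClosed (M : Set E)) {ε : ℝ} (hε0 : 0 ≤ ε) (hε : ε < 1)
    (h : ∀ g : E, ∃ m ∈ M, ‖g - m‖ ≤ ε * ‖g‖) : M = ⊤ := by
  rw [eq_top_iff]
  intro g _
  have key : ∀ n : ℕ, ∃ m ∈ M, ‖g - m‖ ≤ ε ^ n * ‖g‖ := by
    intro n
    induction n with
    | zero => exact ⟨0, M.zero_mem, by simp⟩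
    | succ n ih =>
      obtain ⟨m, hm, hmn⟩ := ih
      obtain ⟨m', hm', hmn'⟩ := h (g - m)
      refine ⟨m + m', M.add_mem hm hm', ?_⟩
      rw [← sub_sub, pow_succ', mul_assoc]
      exact hmn'.trans (mul_le_mul_of_nonneg_left hmn hε0)
  choose m hm hmn using key
  refine hM.mem_of_tendsto (b := Filter.atTop) (f := m) ?_ (Filter.Eventually.of_forall hm)
  rw [tendsto_iff_norm_sub_tendsto_zero]
  refine squeeze_zero (fun _ => norm_nonneg _) (fun n => ?_)
    (by simpa using (tendsto_pow_atTop_nhds_zero_of_lt_one hε0 hε).mul_const ‖g‖)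
  rw [norm_sub_rev]
  exact hmn n

/-- Every element of the completion can be divided with remainder. -/
theorem exists_eq_add [CompleteSpace A] (hT : IsNearShift d T) (g : Alg S) :
    ∃ q r, g = T q + r ∧ DegreeLT S d r := by
  have hclosed : IsClosed ((divMap d T).range : Set (Alg S)) := by
    rw [AddMonoidHom.coe_range]
    exact hT.isometry_divMap.isClosedEmbedding.isClosed_range
  obtain ⟨P, hP, ε, hε0, hε, hTP⟩ := hT.exists_shift
  -- The factor `1 / 2` absorbs the approximation of `g` by a polynomial, `ε` the passage from `P`
  -- to `T`.
  have htop := AddSubgroup.eq_top_of_isClosed_of_contracting (divMap d T).range hclosed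
    (ε := max ε (1 / 2)) (by positivity) (max_lt hε (by norm_num)) fun g => by
      rcases eq_or_ne g 0 with rfl | hg
      · exact ⟨0, zero_mem _, by simp⟩
      have hg0 : 0 < ‖g‖ := norm_pos_iff.mpr hg
      obtain ⟨p, hp⟩ := (Completion.denseRange_coe (α := Ore S)).exists_dist_lt g
        (ε := 1 / 2 * ‖g‖) (by positivity)
      replace hp : ‖g - ofOre S p‖ < 1 / 2 * ‖g‖ := by
        rw [← dist_eq_norm]
        exact hp
      have hpg : ‖p‖ ≤ ‖g‖ := by
        rw [← norm_ofOre p, ← sub_sub_cancel g (ofOre S p)]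
        exact (IsUltrametricDist.norm_sub_le_max_norm _ _).trans (max_le le_rfl (by linarith))
      obtain ⟨q, r, hqr, hr⟩ := hP.exists_eq_add p
      have hq : ‖q‖ ≤ ‖g‖ := (hqr ▸ hP.norm_le_norm_add q hr).trans hpg
      refine ⟨T (ofOre S q) + ofOre S r, ⟨(ofOre S q, fun i => r.coeff i), ?_⟩, ?_⟩
      · change T _ + ofOre S (Ore.ofCoeffs S d fun i => r.coeff i) = _
        rw [← hr.eq_ofCoeffs]
        rfl
      have e : g - (T (ofOre S q) + ofOre S r) =
          (g - ofOre S p) - (T (ofOre S q) - ofOre S (P q)) := by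
        rw [hqr, map_add]; abel
      rw [e, max_mul_of_nonneg _ _ hg0.le, max_comm]
      exact (IsUltrametricDist.norm_sub_le_max_norm _ _).trans (max_le_max hp.le
        ((hTP q).trans (mul_le_mul_of_nonneg_left hq hε0)))
  have hg : g ∈ (divMap d T).range := htop ▸ AddSubgroup.mem_top g
  obtain ⟨x, rfl⟩ := hg
  exact ⟨x.1, _, rfl, _, Ore.degLT_ofCoeffs x.2, rfl⟩

end IsNearShift

end Division

/-! ### Regular elements -/

section Regular

theorem residue_eq_residue_iff {R : Type*} [NormedRing R] [NormOneClass R] [IsUltrametricDist R]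
    {x y : R} (hx : ‖x‖ ≤ 1) (hy : ‖y‖ ≤ 1) : residue x hx = residue y hy ↔ ‖x - y‖ < 1 :=
  Ideal.Quotient.eq

theorem exists_residue_eq {R : Type*} [NormedRing R] [NormOneClass R] [IsUltrametricDist R]
    (c : Residue R) : ∃ (x : R) (hx : ‖x‖ ≤ 1), residue x hx = c := by
  obtain ⟨⟨x, hx⟩, rfl⟩ := Ideal.Quotient.mk_surjective c
  exact ⟨x, hx, rfl⟩

theorem residueMap_residue {R T : Type*} [NormedRing R] [NormOneClass R] [IsUltrametricDist R]
    [NormedRing T] [NormOneClass T] [IsUltrametricDist T] (φ : R →+* T) (hφ : ∀ x, ‖φ x‖ ≤ ‖x‖)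
    (x : R) (hx : ‖x‖ ≤ 1) :
    residueMap φ hφ (residue x hx) = residue (φ x) ((hφ x).trans hx) := rfl

variable [IsUltrametricDist A]

theorem degreeLT_zero (S : OreDatum L A) (d : ℕ) : DegreeLT S d 0 :=
  ⟨0, Ore.degLT_zero d, (map_zero _).symm⟩

variable [NormOneClass A] {d : ℕ} {f : Alg S}

theorem norm_monomial_add_ofCoeffs_le {l : L} (hl : ‖l‖ ≤ 1) {c : Fin d → A}
    (hc : ∀ i, ‖c i‖ ≤ 1) :
    ‖Ore.monomial S d (algebraMap L A l) + Ore.ofCoeffs S d c‖ ≤ 1 := by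
  refine (Ore.norm_add_le_max _ _).trans (max_le ?_ ?_)
  · rwa [Ore.norm_monomial, norm_algebraMap']
  · rw [Ore.norm_ofCoeffs]
    exact (pi_norm_le_iff_of_nonneg zero_le_one).mpr hc

variable [IsUltrametricDist L]

/-- Lifts the expression in the definition of regularity to a genuine skew-polynomial; used both to
extract one from `f` and to prove `w` regular. -/
theorem residue_ofOre_monomial_add_ofCoeffs {l : L} (hl : ‖l‖ ≤ 1) {c : Fin d → A}
    (hc : ∀ i, ‖c i‖ ≤ 1)
    (h : ‖ofOre S (Ore.monomial S d (algebraMap L A l) + Ore.ofCoeffs S d c)‖ ≤ 1) :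
    residueMap (scalar S) (norm_scalar_le S) (residue l hl) * residue (var S) (norm_var_le S) ^ d
        + ∑ i : Fin d, residueMap (const S) (norm_const_le S) (residue (c i) (hc i)) *
            residue (var S) (norm_var_le S) ^ (i : ℕ) =
      residue (ofOre S (Ore.monomial S d (algebraMap L A l) + Ore.ofCoeffs S d c)) h := by
  simp only [residueMap_residue]
  simp only [residue, ← map_pow, ← map_mul, ← map_sum, ← map_add]
  refine congrArg _ (Subtype.ext ?_)
  change _ = ofOre S (Ore.monomial S d (algebraMap L A l) + ∑ i : Fin d, Ore.monomial S i (c i))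
  rw [map_add, map_sum]
  simp only [Ore.monomial_eq, map_mul, map_pow]
  push_cast
  rfl

/-- A regular element is strictly close to a skew-polynomial of the same degree whose leading
coefficient is a scalar of absolute value one. -/
theorem IsRegular.exists_ore (hf : IsRegular S d f) :
    ∃ (l : L) (p : Ore S), ‖l‖ = 1 ∧ p.DegLT (d + 1) ∧ p.coeff d = algebraMap L A l ∧ ‖p‖ ≤ 1 ∧
      ‖f - ofOre S p‖ < 1 := by
  obtain ⟨hf, l, c, h⟩ := hf
  obtain ⟨l₀, hl₀, hl⟩ := exists_residue_eq (l : Residue L)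
  choose c₀ hc₀ hc using fun i => exists_residue_eq (c i)
  have hnorm := norm_monomial_add_ofCoeffs_le (S := S) hl₀ hc₀
  refine ⟨l₀, Ore.monomial S d (algebraMap L A l₀) + Ore.ofCoeffs S d c₀, ?_, ?_, ?_, hnorm, ?_⟩
  -- If `‖l₀‖ < 1`, the unit `l` of the residue field would be zero.
  · refine le_antisymm hl₀ (not_lt.mp fun hlt => ?_)
    have h0 : residue l₀ hl₀ = 0 := Ideal.Quotient.eq_zero_iff_mem.mpr hlt
    have h10 : (1 : Residue L) = 0 := by
      rw [← l.mul_inv, ← hl, h0, zero_mul]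
    have h1 : ‖(1 : L)‖ < 1 := Ideal.Quotient.eq_zero_iff_mem.mp h10
    exact absurd norm_one h1.ne
  · exact (Ore.degLT_monomial d _).add ((Ore.degLT_ofCoeffs c₀).mono d.le_succ)
  · rw [Ore.coeff_add, Ore.coeff_monomial, if_pos rfl, Ore.degLT_ofCoeffs c₀ d le_rfl, add_zero]
  · rw [← residue_eq_residue_iff hf.le (by rwa [norm_ofOre]), h, ← hl]
    simp only [← hc]
    exact residue_ofOre_monomial_add_ofCoeffs hl₀ hc₀ _

theorem isRegular_of_monic {p : Ore S} (hp : p.DegLT (d + 1)) (hd : p.coeff d = 1)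
    (hn : ‖p‖ ≤ 1) : IsRegular S d (ofOre S p) := by
  have hp' : p = Ore.monomial S d (algebraMap L A 1) + Ore.ofCoeffs S d fun i => p.coeff i := by
    have h := hp.sub_monomial.eq_ofCoeffs
    rw [sub_eq_iff_eq_add', hd] at h
    conv_lhs => rw [h]
    rw [map_one (algebraMap L A)]
    congr 2
    funext i
    rw [Ore.coeff_sub, Ore.coeff_monomial, if_neg i.2.ne', sub_zero]
  have hn1 : ‖ofOre S p‖ = 1 := by
    rw [norm_ofOre]
    refine le_antisymm hn ?_
    have := Ore.norm_coeff_le p d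
    rwa [hd, norm_one] at this
  have hc : ∀ i : Fin d, ‖p.coeff i‖ ≤ 1 := fun i => (Ore.norm_coeff_le p i).trans hn
  refine ⟨hn1, 1, fun i => residue (p.coeff i) (hc i), ?_⟩
  have h := residue_ofOre_monomial_add_ofCoeffs (S := S) (norm_one (α := L)).le hc
    (by rw [← hp']; exact hn1.le)
  simp only [← hp'] at h
  exact h.symm

/-- Take `ε = ‖f - p‖`, since `q * f - q * p = q * (f - p)`. -/
theorem IsRegular.isNearShift_mulRight (hf : IsRegular S d f) :
    IsNearShift d (AddMonoidHom.mulRight f) := by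
  obtain ⟨l, p, hl, hp, hd, hn, hfp⟩ := hf.exists_ore
  refine ⟨fun q => (norm_mul_le q f).trans_eq (by rw [hf.1, mul_one]), _,
    Ore.isShift_mulRight hp hn hl hd, _, norm_nonneg _, hfp, fun q => ?_⟩
  rw [AddMonoidHom.mulRight_apply, AddMonoidHom.mulRight_apply, map_mul, ← mul_sub, mul_comm ‖_‖,
    ← norm_ofOre q]
  exact norm_mul_le _ _

theorem IsRegular.isNearShift_mulLeft (hα : Isometry S.α) (hf : IsRegular S d f) :
    IsNearShift d (AddMonoidHom.mulLeft f) := by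
  obtain ⟨l, p, hl, hp, hd, hn, hfp⟩ := hf.exists_ore
  refine ⟨fun q => (norm_mul_le f q).trans_eq (by rw [hf.1, one_mul]), _,
    Ore.isShift_mulLeft hα hp hn hl hd, _, norm_nonneg _, hfp, fun q => ?_⟩
  rw [AddMonoidHom.coe_mulLeft, AddMonoidHom.coe_mulLeft, map_mul, ← sub_mul, ← norm_ofOre q]
  exact norm_mul_le _ _

/-! ### Weierstrass preparation. -/

/-- If `T` maps a scalar of absolute value one to an element strictly close to a monic
skew-polynomial of degree `d`, then it maps some unit to a monic regular one. -/
theorem IsNearShift.exists_isUnit [CompleteSpace A] {T : Alg S →+ Alg S} (hT : IsNearShift d T)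
    {l : L} (hl : ‖l‖ = 1) {p : Ore S} (hp : p.DegLT (d + 1)) (hd : p.coeff d = 1)
    (h : ‖T (scalar S l⁻¹) - ofOre S p‖ < 1) :
    ∃ w q, IsMonicOfDegree S d w ∧ IsRegular S d w ∧ IsUnit q ∧ T q = w := by
  obtain ⟨q, r, hqr, hr⟩ := hT.exists_eq_add (ofOre S (Ore.monomial S d 1))
  have hr1 : ‖r‖ ≤ 1 := by
    have := hT.norm_add_eq q hr
    rw [← hqr, norm_ofOre, Ore.norm_monomial, norm_one] at this
    exact (le_max_right _ _).trans this.ge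
  -- Both terms are monic of degree `d`, so their difference is an admissible remainder and the norm
  -- estimate can compare `q` with `l⁻¹`.
  have hs : DegreeLT S d (ofOre S (Ore.monomial S d 1 - p)) := by
    refine ⟨_, fun n hn => ?_, rfl⟩
    rw [Ore.coeff_sub, Ore.coeff_monomial]
    rcases hn.eq_or_lt with rfl | hlt
    · rw [if_pos rfl, hd, sub_self]
    · rw [if_neg hlt.ne, hp n hlt, sub_self]
  have hqu : ‖q - scalar S l⁻¹‖ < 1 := by
    refine (hT.norm_le_norm_add _ (hr.sub hs)).trans_lt ?_
    have e : T (q - scalar S l⁻¹) + (r - ofOre S (Ore.monomial S d 1 - p)) =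
        -(T (scalar S l⁻¹) - ofOre S p) := by
      rw [map_sub, map_sub (ofOre S), hqr]
      abel
    rwa [e, norm_neg]
  have hl0 : l ≠ 0 := by rintro rfl; simp at hl
  have hq : IsUnit q := by
    have hu : IsUnit (scalar S l) := (IsUnit.mk0 l hl0).map (scalar S)
    -- Then `l * q` is invertible by the geometric series, and so is `q`.
    have h1 : ‖1 - scalar S l * q‖ < 1 := by
      have e : 1 - scalar S l * q = -(scalar S l * (q - scalar S l⁻¹)) := by
        rw [mul_sub, ← map_mul, mul_inv_cancel₀ hl0, map_one, neg_sub]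
      rw [e, norm_neg]
      refine (norm_mul_le _ _).trans_lt ((mul_le_of_le_one_left (norm_nonneg _) ?_).trans_lt hqu)
      exact (norm_scalar_le S l).trans hl.le
    have h2 := isUnit_one_sub_of_norm_lt_one h1
    rw [sub_sub_cancel] at h2
    obtain ⟨u, hu⟩ := hu
    rw [← hu] at h2
    exact (Units.isUnit_units_mul u q).mp h2
  obtain ⟨r, hr, rfl⟩ := hr
  rw [norm_ofOre] at hr1
  have hw : (Ore.monomial S d 1 - r).DegLT (d + 1) :=
    (Ore.degLT_monomial d 1).sub (Ore.DegLT.mono hr d.le_succ)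
  have hwd : (Ore.monomial S d 1 - r).coeff d = 1 := by
    rw [Ore.coeff_sub, Ore.coeff_monomial, if_pos rfl, hr d le_rfl, sub_zero]
  refine ⟨ofOre S (Ore.monomial S d 1 - r), q, ⟨_, hwd, hw, rfl⟩,
    isRegular_of_monic hw hwd ?_, hq, ?_⟩
  · refine (IsUltrametricDist.norm_sub_le_max_norm _ _).trans (max_le ?_ hr1)
    rw [Ore.norm_monomial, norm_one]
  · rw [map_sub, hqr, add_sub_cancel_right]

/-- Scaling by `l⁻¹` makes `p` monic and keeps it strictly close to `l⁻¹ * f`; the factor `e` is the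
inverse of the unit `q` with `q * f = w`. -/
theorem IsRegular.exists_eq_mul_monic [CompleteSpace A] (hf : IsRegular S d f) :
    ∃ w e, IsMonicOfDegree S d w ∧ IsRegular S d w ∧ IsUnit e ∧ f = e * w := by
  obtain ⟨l, p, hl, hp, hd, hn, hfp⟩ := hf.exists_ore
  have hl0 : l ≠ 0 := by rintro rfl; simp at hl
  have h : ‖AddMonoidHom.mulRight f (scalar S l⁻¹) - ofOre S (algebraMap L A l⁻¹ • p)‖ < 1 := by
    rw [← Ore.C_mul, map_mul, AddMonoidHom.mulRight_apply]
    change ‖scalar S l⁻¹ * f - scalar S l⁻¹ * ofOre S p‖ < 1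
    rw [← mul_sub]
    refine (norm_mul_le _ _).trans_lt ((mul_le_of_le_one_left (norm_nonneg _) ?_).trans_lt hfp)
    exact (norm_scalar_le S _).trans (by rw [norm_inv, hl, inv_one])
  obtain ⟨w, q, hw, hwr, ⟨u, rfl⟩, hTq⟩ := hf.isNearShift_mulRight.exists_isUnit hl
    (fun n hn => by rw [Ore.coeff_smul, hp n hn, mul_zero])
    (by rw [Ore.coeff_smul, hd, ← map_mul, inv_mul_cancel₀ hl0, map_one]) h
  exact ⟨w, ↑u⁻¹, hw, hwr, u⁻¹.isUnit, by rw [← hTq]; simp⟩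

theorem IsRegular.exists_eq_monic_mul [CompleteSpace A] (hα : Isometry S.α)
    (hf : IsRegular S d f) :
    ∃ w e, IsMonicOfDegree S d w ∧ IsRegular S d w ∧ IsUnit e ∧ f = w * e := by
  obtain ⟨l, p, hl, hp, hd, hn, hfp⟩ := hf.exists_ore
  have hl0 : l ≠ 0 := by rintro rfl; simp at hl
  have h : ‖AddMonoidHom.mulLeft f (scalar S l⁻¹) - ofOre S (algebraMap L A l⁻¹ • p)‖ < 1 := by
    rw [← Ore.C_mul, (Ore.commute_C_algebraMap _ p).eq, map_mul, AddMonoidHom.coe_mulLeft]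
    change ‖f * scalar S l⁻¹ - ofOre S p * scalar S l⁻¹‖ < 1
    rw [← sub_mul]
    refine (norm_mul_le _ _).trans_lt ((mul_le_of_le_one_right (norm_nonneg _) ?_).trans_lt hfp)
    exact (norm_scalar_le S _).trans (by rw [norm_inv, hl, inv_one])
  obtain ⟨w, q, hw, hwr, ⟨u, rfl⟩, hTq⟩ := (hf.isNearShift_mulLeft hα).exists_isUnit hl
    (fun n hn => by rw [Ore.coeff_smul, hp n hn, mul_zero])
    (by rw [Ore.coeff_smul, hd, ← map_mul, inv_mul_cancel₀ hl0, map_one]) h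
  exact ⟨w, ↑u⁻¹, hw, hwr, u⁻¹.isUnit, by rw [← hTq]; simp⟩

/-- Dividing the polynomial `e * w` by `w` inside the Ore extension gives a polynomial quotient;
uniqueness in the completion, against remainder `0`, identifies it with `e`. -/
theorem IsRegular.isPoly_of_mul_monic {w e : Alg S} (hw : IsRegular S d w)
    (hm : IsMonicOfDegree S d w) (h : IsPoly S (e * w)) : IsPoly S e := by
  obtain ⟨g, hg⟩ := h
  have hT := hw.isNearShift_mulRight
  have hn := hw.1
  obtain ⟨p, hd, hp, rfl⟩ := hm
  rw [norm_ofOre] at hn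
  obtain ⟨q, r, rfl, hr⟩ := (Ore.isShift_mulRight hp hn.le (norm_one (α := L))
    (by rw [hd, map_one])).exists_eq_add g
  refine ⟨q, (hT.unique (degreeLT_zero S d) ⟨r, hr, rfl⟩ ?_).1⟩
  rw [AddMonoidHom.mulRight_apply, AddMonoidHom.mulRight_apply, add_zero, hg,
    AddMonoidHom.mulRight_apply, map_add, map_mul]

theorem IsRegular.isPoly_of_monic_mul (hα : Isometry S.α) {w e : Alg S} (hw : IsRegular S d w)
    (hm : IsMonicOfDegree S d w) (h : IsPoly S (w * e)) : IsPoly S e := by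
  obtain ⟨g, hg⟩ := h
  have hT := hw.isNearShift_mulLeft hα
  have hn := hw.1
  obtain ⟨p, hd, hp, rfl⟩ := hm
  rw [norm_ofOre] at hn
  obtain ⟨q, r, rfl, hr⟩ := (Ore.isShift_mulLeft hα hp hn.le (norm_one (α := L))
    (by rw [hd, map_one])).exists_eq_add g
  refine ⟨q, (hT.unique (degreeLT_zero S d) ⟨r, hr, rfl⟩ ?_).1⟩
  rw [AddMonoidHom.coe_mulLeft, add_zero, hg, AddMonoidHom.coe_mulLeft, map_add, map_mul]

end Regular

end Ore

end SkewTate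

theorem mainTheorem2 {L A : Type*} [NormedField L] [IsUltrametricDist L]
    (hL : SkewTate.IsDiscretelyValued L)
    [NormedRing A] [NormOneClass A] [NormedAlgebra L A] [IsUltrametricDist A] [CompleteSpace A]
    (hA : SkewTate.IsSolid L A)
    (S : SkewTate.OreDatum L A) (d : ℕ) (f : SkewTate.Alg S) (hf : SkewTate.IsRegular S d f) :
    (∀ g : SkewTate.Alg S,
      (∃! qr : SkewTate.Alg S × SkewTate.Alg S,
        g = qr.1 * f + qr.2 ∧ SkewTate.DegreeLT S d qr.2) ∧
      ∀ q r : SkewTate.Alg S, g = q * f + r → SkewTate.DegreeLT S d r →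
        ‖g‖ = max ‖q‖ ‖r‖) ∧
    (∃ w e : SkewTate.Alg S,
      SkewTate.IsMonicOfDegree S d w ∧ SkewTate.IsRegular S d w ∧ IsUnit e ∧ f = e * w ∧
      (SkewTate.IsPoly S f → SkewTate.IsPoly S e)) ∧
    (Isometry S.α →
      ∃ w e : SkewTate.Alg S,
        SkewTate.IsMonicOfDegree S d w ∧ SkewTate.IsRegular S d w ∧ IsUnit e ∧ f = w * e ∧
        (SkewTate.IsPoly S f → SkewTate.IsPoly S e)) := by
  refine ⟨fun g => ?_, ?_, fun hα => ?_⟩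
  · have hT := hf.isNearShift_mulRight
    obtain ⟨q, r, hg, hr⟩ := hT.exists_eq_add g
    refine ⟨⟨(q, r), ⟨hg, hr⟩, ?_⟩, ?_⟩
    · rintro ⟨q', r'⟩ ⟨hg', hr'⟩
      obtain ⟨rfl, rfl⟩ := hT.unique hr' hr (hg'.symm.trans hg)
      rfl
    · rintro q' r' rfl hr'
      exact hT.norm_add_eq q' hr'
  · obtain ⟨w, e, hw, hwr, he, rfl⟩ := hf.exists_eq_mul_monic
    exact ⟨w, e, hw, hwr, he, rfl, hwr.isPoly_of_mul_monic hw⟩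
  · obtain ⟨w, e, hw, hwr, he, rfl⟩ := hf.exists_eq_monic_mul hα
    exact ⟨w, e, hw, hwr, he, rfl, hwr.isPoly_of_monic_mul hα hw⟩
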